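/- An analytic field is a field that is complete with respect to a (possibly trivial) non-archimedean multiplicative real-valued absolute value; an extension $K/k$ of analytic fields is a field extension whose absolute value on $K$ extends that on $k$. Let $K/k$ be an extension of algebraically closed analytic fields. For a subset $S\subseteq K$ let $\widehat{k(S)^a}\subseteq K$ be the topological closure in $K$ of the set of elements algebraic over $k(S)$. Call $S$ topologically-algebraically independent over $k$ if $\widehat{k(S')^a}\subsetneq\widehat{k(S)^a}$ for every $S'\subsetneq S$, and let $\mathrm{topdeg}(K/k)$ be the supremum of the cardinals of all such sets $S$. Let $I_{K/k}$ be the set, ordered by inclusion, of all intermediate fields $k\subseteq F\subseteq K$ that are complete and algebraically closed. The cofinality of $I_{K/k}$ is understood as the supremum of all ordinals $\alpha$ for which there is a strictly increasing chain $(F_i)_{i\le\alpha}$ indexed by the ordinals $i\le\alpha$ in $I_{K/k}$ (equivalently, the supremum of the order types of well-ordered chains of fields $F\in I_{K/k}$ with $F\neq K$). Theorem. Let $K/k$ be an extension of algebraically closed analytic fields such that $\mathrm{topdeg}(K/k)=d$ is finite and the residue field $\tilde k$ of $k$ has positive characteristic. Then the cofinality of $I_{K/k}$ does not exceed the ordinal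 $d\omega_1$, that is, the ordinal sum $\omega_1+\dots+\omega_1$ of $d$ copies of the first uncountable ordinal $\omega_1$ (written $\omega_1\cdot d$ in the usual convention for ordinal multiplication). -/

import Mathlib

open scoped Ordinal Cardinal

universe u

/-- An extension `K/k` of analytic fields (complete non-archimedean real valued fields, possibly
trivially valued) is encoded by `NormedField`, `IsUltrametricDist` and `CompleteSpace` on both
fields together with `NormedAlgebra k K`, which makes `algebraMap k K` norm-preserving.

The field `k(S)^a` completed, as a subset of the algebraically closed complete field `K`:
the topological closure in `K` of the set of elements algebraic over `k(S)`. -/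
def taClosure (k : Type*) {K : Type*} [NormedField k] [NormedField K] [NormedAlgebra k K]
    (S : Set K) : Set K :=
  closure {x : K | IsAlgebraic (IntermediateField.adjoin k S) x}

/-- `S` is topologically-algebraically independent over `k`: passing to any proper subset
strictly decreases the completed algebraic closure that it generates. -/
def TAIndependent (k : Type*) {K : Type*} [NormedField k] [NormedField K] [NormedAlgebra k K]
    (S : Set K) : Prop :=
  ∀ S' : Set K, S' ⊂ S → taClosure k S' ⊂ taClosure k S

/-- The topological transcendence degree of `K/k` (for `K` algebraically closed): the supremum of
the cardinals of all topologically-algebraically independent sets. -/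
noncomputable def topdeg (k K : Type*) [NormedField k] [NormedField K] [NormedAlgebra k K] :
    Cardinal :=
  ⨆ S : {S : Set K // TAIndependent k S}, #S.1

/-- Every topologically-algebraically independent set has cardinality at most `topdeg k K`. -/
theorem mk_le_topdeg (k K : Type*) [NormedField k] [NormedField K] [NormedAlgebra k K]
    (S : Set K) (hS : TAIndependent k S) : #S ≤ topdeg k K :=
  le_ciSup (f := fun S : {S : Set K // TAIndependent k S} => #S.1)
    Cardinal.bddAbove_of_small ⟨S, hS⟩

/-- The residue field of a non-archimedean valued field: the unit ball modulo the open
unit ball. -/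
abbrev AnalyticResidueField (k : Type*) [NormedField k] [IsUltrametricDist k] : Type _ :=
  IsLocalRing.ResidueField (NormedField.valuation (K := k)).valuationSubring

/-- The set `I_{K/k}` of algebraically closed analytic (that is, complete for the induced norm)
intermediate fields `k ⊆ F ⊆ K`, ordered by inclusion. -/
abbrev AnalyticSubextension (k K : Type*) [NormedField k] [NormedField K] [NormedAlgebra k K] :
    Type _ :=
  {F : IntermediateField k K // IsComplete (F : Set K) ∧ IsAlgClosed F}

/-- The cofinality of a partially ordered set as an ordinal, in the sense of lengths of
well-ordered chains: the supremum of all ordinals `a` such that there is a strictly increasing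
chain `(F i)_{i ≤ a}` in `P`. (If `P` has a greatest element, this is the same as the
supremum of the order types of well-ordered chains avoiding the greatest element.) -/
noncomputable def chainCofinality (P : Type u) [PartialOrder P] : Ordinal.{u} :=
  sSup {a : Ordinal.{u} | ∃ F : Set.Iic a → P, StrictMono F}

/-- The supremum in `chainCofinality` is taken over a bounded set. -/
theorem bddAbove_chainCofinality (P : Type u) [PartialOrder P] :
    BddAbove {a : Ordinal.{u} | ∃ F : Set.Iic a → P, StrictMono F} := by
  refine ⟨(Order.succ #P).ord, ?_⟩
  rintro a ⟨F, hF⟩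
  by_contra! h
  have h1 : Order.succ #P ≤ a.card := Cardinal.ord_le.1 h.le
  have h2 := Cardinal.mk_le_of_injective
    (f := fun i : Set.Iio a => ULift.up.{u + 1} (F ⟨i.1, Set.mem_Iic.2 <| le_of_lt (Set.mem_Iio.1 i.2)⟩))
    (fun x y hxy => by
      have := hF.injective (ULift.up.inj hxy)
      exact Subtype.ext (congrArg (fun z : Set.Iic a => z.1) this))
  rw [Cardinal.mk_Iio_ordinal, Cardinal.mk_uLift, Cardinal.lift_le] at h2
  exact absurd (h1.trans h2) (not_le.2 (Order.lt_succ _))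

/-- The cofinality is at most `b` if and only if every strictly increasing chain `(F i)_{i ≤ a}`
has `a ≤ b`. -/
theorem chainCofinality_le_iff (P : Type u) [PartialOrder P] (b : Ordinal.{u}) :
    chainCofinality P ≤ b ↔ ∀ (a : Ordinal.{u}) (F : Set.Iic a → P), StrictMono F → a ≤ b := by
  constructor
  · intro h a F hF
    exact (le_csSup (bddAbove_chainCofinality P) ⟨F, hF⟩).trans h
  · intro h
    exact csSup_le' (by rintro a ⟨F, hF⟩; exact h a F hF)

/-! A chain of length exceeding `ω_ 1 * d` yields `d + 1` topologically independent elements,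
contradicting `topdeg k K = d`. They are collected downwards, one from above all blocks of `ω_ 1`
indices and one from each block.

Let a finite `T` be independent over a field above a block. The distance from a point to the fields
of the block is an antitone real function on `ω_ 1`, hence eventually constant. If `x` is equally
far from `F` and `G ⊇ F`, the completed algebraic closure of `F(x)` meets `G` only in `F`
(`mem_of_mem_taClosure_insert`). Adjoining the points of `T` in turn, some field `F_t` of the block
satisfies: `T` generates over `F_t` no new element of the block. Any `x` in `F_{t+1}` outside `F_t`
then enlarges `T`, with independence over `F_t`.

The exchange statement `infDist_le_of_isAlgebraic_adjoin` compares Gauss norms. Let `R(x, w) = 0`.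
On a disc reaching from `x` almost exactly to `F`, `R(X, z)` has norm about `|R(x, z)|`, its roots
being far away. Expanding around a point of `F` carries this bound to `R(x, Z)` near `z`; dividing
by `Z - w` bounds `|z - w|` below. Distances need not be attained, so factors `c, e > 1` are carried
along and sent to 1. -/

theorem le_of_forall_one_lt_le_pow_mul {s t : ℝ} {n : ℕ} (h : ∀ c : ℝ, 1 < c → s ≤ c ^ n * t) :
    s ≤ t := by
  have hc : Filter.Tendsto (fun c : ℝ => c ^ n * t) (nhdsWithin 1 (Set.Ioi 1))
      (nhds (1 ^ n * t)) :=
    (Continuous.tendsto (by fun_prop) 1).mono_left nhdsWithin_le_nhds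
  simpa using ge_of_tendsto hc (Filter.eventually_of_mem self_mem_nhdsWithin h)

/-! ### Gauss norms on discs and the exchange property. -/

section Exchange

open Polynomial

variable {F K : Type*} [Field F] [NormedField K] [Algebra F K]

theorem isNonarchimedean_toAbsoluteValue [IsUltrametricDist K] :
    IsNonarchimedean (NormedField.toAbsoluteValue K) :=
  fun x y => IsUltrametricDist.norm_add_le_max x y

/-- The Gauss norm of `p` on the disc with center `a` and radius `ρ`. -/
noncomputable def discNorm (a : K) (ρ : ℝ) (p : K[X]) : ℝ :=
  (taylor a p).gaussNorm (NormedField.toAbsoluteValue K) ρ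

/-- Gauss's lemma: it allows estimates root by root, and splitting off the factor `Z - w`. -/
theorem discNorm_mul [IsUltrametricDist K] (a : K) {ρ : ℝ} (hρ : 0 < ρ) (p q : K[X]) :
    discNorm a ρ (p * q) = discNorm a ρ p * discNorm a ρ q := by
  rw [discNorm, taylor_mul, gaussNorm_mul isNonarchimedean_toAbsoluteValue hρ]
  rfl

theorem discNorm_C (a : K) (ρ : ℝ) (c : K) : discNorm a ρ (C c) = ‖c‖ := by
  simp [discNorm, NormedField.toAbsoluteValue]

theorem discNorm_nonneg (a : K) {ρ : ℝ} (hρ : 0 ≤ ρ) (p : K[X]) : 0 ≤ discNorm a ρ p :=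
  gaussNorm_nonneg _ _ hρ

theorem norm_coeff_taylor_mul_pow_le_discNorm (a : K) {ρ : ℝ} (hρ : 0 ≤ ρ) (p : K[X]) (i : ℕ) :
    ‖(taylor a p).coeff i‖ * ρ ^ i ≤ discNorm a ρ p :=
  le_gaussNorm (NormedField.toAbsoluteValue K) (taylor a p) hρ i

theorem discNorm_le {a : K} {ρ : ℝ} {p : K[X]} {B : ℝ}
    (h : ∀ i, ‖(taylor a p).coeff i‖ * ρ ^ i ≤ B) : discNorm a ρ p ≤ B := by
  obtain ⟨i, hi⟩ := exists_eq_gaussNorm (NormedField.toAbsoluteValue K) ρ (taylor a p)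
  rw [discNorm, hi]
  exact h i

/-- The value at `x` is bounded by the Gauss norm on any disc through `x`. -/
theorem norm_eval_le_discNorm [IsUltrametricDist K] (x a : K) (p : K[X]) :
    ‖p.eval x‖ ≤ discNorm a ‖x - a‖ p := by
  have h : p.eval x = (taylor a p).eval (x - a) := by simp [taylor_eval]
  rw [h, eval_eq_sum_range]
  refine IsUltrametricDist.norm_sum_le_of_forall_le_of_nonneg
    (discNorm_nonneg a (norm_nonneg _) p) fun i _ => ?_
  rw [norm_mul, norm_pow]
  exact norm_coeff_taylor_mul_pow_le_discNorm a (norm_nonneg _) p i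

theorem le_discNorm_X_sub_C (a : K) {ρ : ℝ} (hρ : 0 ≤ ρ) (y : K) :
    ρ ≤ discNorm a ρ (X - C y) := by
  have h := norm_coeff_taylor_mul_pow_le_discNorm a hρ (X - C y) 1
  simpa [taylor_X, taylor_C, coeff_C] using h

theorem discNorm_X_sub_C_le (a : K) {ρ : ℝ} (hρ : 0 ≤ ρ) (y : K) :
    discNorm a ρ (X - C y) ≤ max ρ ‖a - y‖ := by
  refine discNorm_le fun i => ?_
  rcases i with _ | _ | i
  · simp [taylor_X, taylor_C]
  · simp [taylor_X, taylor_C]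
  · simp [taylor_X, taylor_C, coeff_X, hρ]

/-- If a disc around `x` is not much larger than the distances from `x` to the roots of `p`, then
the Gauss norm of `p` on this disc is not much larger than the value at `x`. -/
theorem discNorm_le_pow_mul_norm_eval [IsUltrametricDist K] {p : K[X]} (hp : p.Splits) {x a : K} (hxa : 0 < ‖x - a‖)
    {c : ℝ} (hc : 1 ≤ c) (h : ∀ y ∈ p.roots, ‖x - a‖ ≤ c * ‖x - y‖) :
    discNorm a ‖x - a‖ p ≤ c ^ p.natDegree * ‖p.eval x‖ := by
  have key : ∀ s : Multiset K, (∀ y ∈ s, ‖x - a‖ ≤ c * ‖x - y‖) →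
      discNorm a ‖x - a‖ (s.map (X - C ·)).prod ≤
        c ^ Multiset.card s * ‖(s.map (X - C ·)).prod.eval x‖ := by
    intro s
    induction s using Multiset.induction_on with
    | empty => intro _; simpa using (discNorm_C a ‖x - a‖ 1).le
    | cons y s ih =>
      intro hs
      have h1 := ih fun y hy => hs y (Multiset.mem_cons_of_mem hy)
      have hy := hs y (Multiset.mem_cons_self y s)
      have h2 : discNorm a ‖x - a‖ (X - C y) ≤ c * ‖x - y‖ := by
        refine (discNorm_X_sub_C_le a hxa.le y).trans (max_le hy ?_)
        have h3 : ‖a - y‖ ≤ max ‖a - x‖ ‖x - y‖ := by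
          simpa using IsUltrametricDist.norm_add_le_max (a - x) (x - y)
        refine h3.trans (max_le (by rwa [norm_sub_rev]) ?_)
        exact le_mul_of_one_le_left (norm_nonneg _) hc
      rw [Multiset.map_cons, Multiset.prod_cons, discNorm_mul a hxa, Multiset.card_cons, eval_mul,
        norm_mul, pow_succ', mul_mul_mul_comm]
      refine mul_le_mul (by simpa using h2) h1 (discNorm_nonneg a hxa.le _) (by positivity)
  have hcard := hp.natDegree_eq_card_roots
  have hprod := hp.eq_prod_roots
  generalize p.roots = s at *
  rw [hcard, hprod, discNorm_mul a hxa, discNorm_C, eval_mul, eval_C, norm_mul, mul_left_comm]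
  exact mul_le_mul_of_nonneg_left (key _ h) (norm_nonneg _)

/-- The polynomial `R(x, Z)` in `Z`. -/
noncomputable abbrev evalOuter (R : F[X][X]) (x : K) : K[X] :=
  R.eval₂ (mapRingHom (algebraMap F K)) (C x)

theorem eval_evalOuter (R : F[X][X]) (x z : K) :
    (evalOuter R x).eval z = (R.map (aeval (R := F) z : F[X] →+* K)).eval x := by
  rw [eval_map, evalOuter, ← coe_evalRingHom, hom_eval₂]
  congr 1
  · ext <;> simp
  · simp

/-- Centring at a point of `F` keeps the coefficients in `F[Z]`, so their roots are algebraic over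
`F` and hence far from `z`. -/
theorem evalOuter_eq_sum_taylor (R : F[X][X]) (x : K) (a : F) :
    evalOuter R x = ∑ i ∈ Finset.range ((taylor (C a) R).natDegree + 1),
      ((taylor (C a) R).coeff i).map (algebraMap F K) * C ((x - algebraMap F K a) ^ i) := by
  have h : evalOuter R x = evalOuter (taylor (C a) R) (x - algebraMap F K a) := by
    rw [evalOuter, evalOuter, taylor_apply, eval₂_comp]
    simp
  rw [h, evalOuter, eval₂_eq_sum_range]
  simp

/-- A disc norm estimate for `R(X, z)` as a polynomial in `X` yields one for `R(x, Z)` as a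
polynomial in `Z`. -/
theorem exists_discNorm_evalOuter_le [IsUltrametricDist K] [IsAlgClosed K] (R : F[X][X]) {x z : K}
    {a : F} (hxa : 0 < ‖x - algebraMap F K a‖) {c : ℝ} (hc : 1 ≤ c)
    (hx : ∀ y ∈ (R.map (aeval (R := F) z : F[X] →+* K)).roots,
      ‖x - algebraMap F K a‖ ≤ c * ‖x - y‖) :
    ∃ n : ℕ, ∀ (e : ℝ) (b : K), 1 ≤ e → 0 < ‖z - b‖ →
      (∀ y : K, IsAlgebraic F y → ‖z - b‖ ≤ e * ‖z - y‖) →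
      discNorm b ‖z - b‖ (evalOuter R x) ≤ e ^ n *
        (c ^ (R.map (aeval (R := F) z : F[X] →+* K)).natDegree * ‖(evalOuter R x).eval z‖) := by
  set q : K[X] := R.map (aeval (R := F) z : F[X] →+* K) with hq
  set T : F[X][X] := taylor (C a) R with hT
  -- This exponent depends neither on `e` nor on `b`, so `e` can tend to 1 while `c` stays fixed.
  refine ⟨(Finset.range (T.natDegree + 1)).sup fun i => (T.coeff i).natDegree, ?_⟩
  intro e b he hzb hz
  have hqT : taylor (algebraMap F K a) q = T.map (aeval (R := F) z : F[X] →+* K) := by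
    rw [hT, hq, map_taylor]
    simp
  -- The left side is a term of the Gauss norm of `R(X, z)` around `a`.
  have hB : ∀ i, ‖((T.coeff i).map (algebraMap F K)).eval z‖ * ‖x - algebraMap F K a‖ ^ i ≤
      c ^ q.natDegree * ‖(evalOuter R x).eval z‖ := by
    intro i
    rw [eval_evalOuter, ← hq]
    refine le_trans ?_ (discNorm_le_pow_mul_norm_eval (IsAlgClosed.splits q) hxa hc hx)
    refine le_trans (le_of_eq ?_)
      (norm_coeff_taylor_mul_pow_le_discNorm (algebraMap F K a) hxa.le q i)
    rw [hqT, coeff_map, eval_map_algebraMap]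
    rfl
  set B := c ^ q.natDegree * ‖(evalOuter R x).eval z‖
  have hB0 : 0 ≤ B := by positivity
  refine discNorm_le fun j => ?_
  rw [evalOuter_eq_sum_taylor R x a, map_sum, finsetSum_coeff, ← norm_pow, ← norm_mul,
    Finset.sum_mul]
  refine IsUltrametricDist.norm_sum_le_of_forall_le_of_nonneg (by positivity) fun i hi => ?_
  set f := (T.coeff i).map (algebraMap F K) with hf
  have h1 : discNorm b ‖z - b‖ f ≤ e ^ f.natDegree * ‖f.eval z‖ :=
    discNorm_le_pow_mul_norm_eval (IsAlgClosed.splits f) hzb he fun y hy => hz y <|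
      ⟨T.coeff i, fun h0 => by simp [hf, h0] at hy, by
        rw [← eval_map_algebraMap]; exact (mem_roots'.1 hy).2⟩
  have h2 : e ^ f.natDegree ≤
      e ^ (Finset.range (T.natDegree + 1)).sup fun i => (T.coeff i).natDegree := by
    refine pow_le_pow_right₀ he ?_
    rw [hf, natDegree_map]
    exact Finset.le_sup (f := fun i => (T.coeff i).natDegree) hi
  calc ‖(taylor b (f * C ((x - algebraMap F K a) ^ i))).coeff j * (z - b) ^ j‖
      = ‖(taylor b f).coeff j‖ * ‖z - b‖ ^ j * ‖x - algebraMap F K a‖ ^ i := by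
        rw [taylor_mul, taylor_C, coeff_mul_C, norm_mul, norm_mul, norm_pow, norm_pow]
        ring
    _ ≤ e ^ f.natDegree * ‖f.eval z‖ * ‖x - algebraMap F K a‖ ^ i := by
        refine mul_le_mul_of_nonneg_right ?_ (by positivity)
        exact (norm_coeff_taylor_mul_pow_le_discNorm b hzb.le f j).trans h1
    _ = e ^ f.natDegree * (‖f.eval z‖ * ‖x - algebraMap F K a‖ ^ i) := mul_assoc _ _ _
    _ ≤ _ := mul_le_mul h2 (hB i) (by positivity) (by positivity)

theorem evalOuter_swap (P : F[X][X]) (x : K) :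
    evalOuter (Bivariate.swap P) x = P.map (aeval (R := F) x : F[X] →+* K) := by
  have h : (eval₂RingHom (mapRingHom (algebraMap F K)) (C x)).comp
      (Bivariate.swap (R := F) : F[X][X] →+* F[X][X]) =
        mapRingHom (aeval (R := F) x : F[X] →+* K) := by
    ext <;> simp [Bivariate.swap_apply]
  exact RingHom.congr_fun h P

/-- An element algebraic over `F(x)` is a root of a nonzero polynomial `R(x, Z)` with `R` over
`F`. -/
theorem exists_evalOuter_of_isAlgebraic_adjoin {x w : K}
    (hw : IsAlgebraic (IntermediateField.adjoin F {x}) w) :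
    ∃ R : F[X][X], evalOuter R x ≠ 0 ∧ (evalOuter R x).eval w = 0 := by
  open scoped IntermediateField.algebraAdjoinAdjoin in
  rw [← IsFractionRing.isAlgebraic_iff (Algebra.adjoin F {x})
    (IntermediateField.adjoin F {x}) K] at hw
  obtain ⟨p, hp0, hp⟩ := hw
  let φ : F[X] →+* Algebra.adjoin F {x} :=
    ((aeval (R := F) (⟨x, Algebra.self_mem_adjoin_singleton F x⟩ : Algebra.adjoin F {x}) :
      F[X] →ₐ[F] Algebra.adjoin F {x}) : F[X] →+* Algebra.adjoin F {x})
  have hφ : Function.Surjective φ := by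
    rintro ⟨y, hy⟩
    obtain ⟨f, rfl⟩ := Algebra.adjoin_singleton_eq_range_aeval F x ▸ hy
    refine ⟨f, Subtype.ext ?_⟩
    simp [φ]
  obtain ⟨P, rfl⟩ := map_surjective φ hφ p
  have key : evalOuter (Bivariate.swap P) x =
      (P.map φ).map (algebraMap (Algebra.adjoin F {x}) K) := by
    rw [evalOuter_swap, Polynomial.map_map]
    congr 1
    ext <;> simp [φ]
  refine ⟨Bivariate.swap P, ?_, ?_⟩
  · rw [key]
    exact (Polynomial.map_ne_zero_iff Subtype.val_injective).2 hp0
  · rw [key, eval_map_algebraMap]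
    exact hp

/-- Exchange property: if no element algebraic over `F(z)` is closer to `x` than `F` is, then
no element algebraic over `F(x)` is closer to `z` than `F` is. -/
theorem infDist_le_of_isAlgebraic_adjoin [IsUltrametricDist K] [IsAlgClosed K]
    (hF : ∀ y : K, IsAlgebraic F y → y ∈ Set.range (algebraMap F K)) {x z w : K}
    (hx : 0 < Metric.infDist x (Set.range (algebraMap F K)))
    (h : ∀ y, IsAlgebraic (IntermediateField.adjoin F {z}) y →
      Metric.infDist x (Set.range (algebraMap F K)) ≤ ‖x - y‖)
    (hw : IsAlgebraic (IntermediateField.adjoin F {x}) w) :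
    Metric.infDist z (Set.range (algebraMap F K)) ≤ ‖z - w‖ := by
  have hne : (Set.range (algebraMap F K)).Nonempty := Set.range_nonempty _
  set r := Metric.infDist x (Set.range (algebraMap F K))
  set s := Metric.infDist z (Set.range (algebraMap F K))
  have hs_le : ∀ y : K, IsAlgebraic F y → s ≤ ‖z - y‖ := fun y hy => by
    rw [← dist_eq_norm]
    exact Metric.infDist_le_dist_of_mem (hF y hy)
  rcases (Metric.infDist_nonneg : 0 ≤ s).eq_or_lt with hs | hs
  · exact hs.symm.le.trans (norm_nonneg _)
  have hzF : Transcendental F z := fun hz => by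
    simpa using hs.trans_le (hs_le z hz)
  obtain ⟨R, hR0, hRw⟩ := exists_evalOuter_of_isAlgebraic_adjoin hw
  have hRne : R ≠ 0 := by rintro rfl; simp at hR0
  set q : K[X] := R.map (aeval (R := F) z : F[X] →+* K) with hq
  have hq0 : q ≠ 0 :=
    (Polynomial.map_ne_zero_iff (transcendental_iff_injective.1 hzF)).2 hRne
  -- Roots of `R(X, z)` are algebraic over `F(z)`, so the hypothesis keeps them at distance at least
  -- `r` from `x`.
  have hroot : ∀ y, q.IsRoot y → r ≤ ‖x - y‖ := by
    intro y hy
    have hmap : (R.map (aeval (R := F) (IntermediateField.AdjoinSimple.gen F z) :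
        F[X] →+* IntermediateField.adjoin F {z})).map (algebraMap _ K) = q := by
      rw [hq, Polynomial.map_map]
      congr 1
      ext <;> simp
    refine h y ⟨R.map (aeval (R := F) (IntermediateField.AdjoinSimple.gen F z) :
      F[X] →+* IntermediateField.adjoin F {z}), ?_, ?_⟩
    · intro h0
      exact hq0 (by rw [← hmap, h0, Polynomial.map_zero])
    · rw [← eval_map_algebraMap, hmap]
      exact hy
  have hz0 : (evalOuter R x).eval z ≠ 0 := by
    intro h0
    rw [eval_evalOuter] at h0
    simpa using hx.trans_le (hroot x h0)
  obtain ⟨p, hp⟩ := dvd_iff_isRoot.2 hRw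
  have hpz : 0 < ‖p.eval z‖ := by
    rw [norm_pos_iff]
    rintro h0
    simp [hp, h0] at hz0
  have key : ∀ c : ℝ, 1 < c → s ≤ c ^ q.natDegree * ‖z - w‖ := by
    intro c hc
    obtain ⟨_, ⟨a, rfl⟩, ha⟩ := (Metric.infDist_lt_iff hne).1 (lt_mul_of_one_lt_left hx hc)
    have hxa : 0 < ‖x - algebraMap F K a‖ :=
      hx.trans_le (dist_eq_norm x (algebraMap F K a) ▸ Metric.infDist_le_dist_of_mem ⟨a, rfl⟩)
    obtain ⟨n, hn⟩ := exists_discNorm_evalOuter_le R hxa hc.le (z := z) fun y hy => by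
      rw [dist_eq_norm] at ha
      have := hroot y (mem_roots'.1 hy).2
      exact ha.le.trans (by gcongr)
    have key2 : ∀ e : ℝ, 1 < e → s ≤ e ^ n * (c ^ q.natDegree * ‖z - w‖) := by
      intro e he
      obtain ⟨b, hb, hbs⟩ := (Metric.infDist_lt_iff hne).1 (lt_mul_of_one_lt_left hs he)
      rw [dist_eq_norm] at hbs
      have hzb : s ≤ ‖z - b‖ := by
        rw [← dist_eq_norm]
        exact Metric.infDist_le_dist_of_mem hb
      have h1 := hn e b he.le (hs.trans_le hzb) fun y hy =>
        hbs.le.trans (mul_le_mul_of_nonneg_left (hs_le y hy) (by positivity))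
      rw [hp, discNorm_mul b (hs.trans_le hzb), eval_mul, norm_mul] at h1
      refine le_of_mul_le_mul_right ?_ hpz
      -- The factor `Z - w` has norm at least the radius, which is at least `s`; the factor `p` has
      -- norm at least its value at `z`.
      calc s * ‖p.eval z‖ ≤ discNorm b ‖z - b‖ (X - C w) * discNorm b ‖z - b‖ p := by
            refine mul_le_mul (hzb.trans (le_discNorm_X_sub_C b (norm_nonneg _) w))
              (norm_eval_le_discNorm z b p) (norm_nonneg _)
              (discNorm_nonneg b (norm_nonneg _) _)
        _ ≤ _ := h1
        _ = _ := by simp; ring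
    exact le_of_forall_one_lt_le_pow_mul key2
  exact le_of_forall_one_lt_le_pow_mul key

end Exchange

/-! ### Completed algebraic closures and their behaviour along chains. -/

section TAClosure

open Polynomial

variable {k K : Type*} [NormedField k] [NormedField K] [NormedAlgebra k K]

theorem isAlgebraic_of_le {R K : Type*} [Field R] [Field K] [Algebra R K]
    {A B : IntermediateField R K} (h : A ≤ B) {x : K}
    (hx : IsAlgebraic A x) : IsAlgebraic B x :=
  hx.ringHom_of_comp_eq (IntermediateField.inclusion h) (RingHom.id K)
    (IntermediateField.inclusion_injective h) rfl

theorem taClosure_mono {S T : Set K} (h : S ⊆ T) : taClosure k S ⊆ taClosure k T :=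
  closure_mono fun _ hx => isAlgebraic_of_le (IntermediateField.adjoin.mono k S T h) hx

theorem subset_taClosure (S : Set K) : S ⊆ taClosure k S := fun x hx =>
  subset_closure <| isAlgebraic_algebraMap
    (⟨x, IntermediateField.subset_adjoin k S hx⟩ : IntermediateField.adjoin k S)

theorem mem_of_isAlgebraic_of_isAlgClosed {R K : Type*} [Field R] [Field K] [Algebra R K]
    {F : IntermediateField R K} [IsAlgClosed F] {y : K} (hy : IsAlgebraic F y) : y ∈ F := by
  obtain ⟨c, rfl⟩ := minpoly.mem_range_of_degree_eq_one F y <|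
    IsAlgClosed.degree_eq_one_of_irreducible F (minpoly.irreducible hy.isIntegral)
  exact c.2

/-- An analytic subextension containing `S` contains the completed algebraic closure of `k(S)`. -/
theorem taClosure_subset (F : AnalyticSubextension k K) {S : Set K} (h : S ⊆ F.1) :
    taClosure k S ⊆ F.1 := by
  have := F.2.2
  refine closure_minimal (fun x hx => ?_) F.2.1.isClosed
  exact mem_of_isAlgebraic_of_isAlgClosed
    (isAlgebraic_of_le (IntermediateField.adjoin_le_iff.2 h) hx)

/-- A closed subfield of an algebraically closed normed field is algebraically closed if it has a
dense algebraically closed subfield. -/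
theorem isAlgClosed_of_denseRange_of_isClosed {A E K : Type*} [Field A] [IsAlgClosed A]
    [NormedField E] [Algebra A E] [NormedField K] [NormedAlgebra E K] [IsAlgClosed K]
    (hd : DenseRange (algebraMap A E)) (hE : IsClosed (Set.range (algebraMap E K))) :
    IsAlgClosed E := by
  refine IsAlgClosed.of_exists_root _ fun f hf hirr => ?_
  obtain ⟨a, ha⟩ := IsAlgClosed.exists_aeval_eq_zero K f (degree_pos_of_irreducible hirr).ne'
  have hn : f.natDegree ≠ 0 := hirr.natDegree_pos.ne'
  suffices h : a ∈ Set.range (algebraMap E K) by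
    obtain ⟨c, rfl⟩ := h
    refine ⟨c, (algebraMap E K).injective ?_⟩
    rwa [map_zero, ← aeval_algebraMap_apply_eq_algebraMap_eval]
  rw [← hE.closure_eq, Metric.mem_closure_iff]
  intro δ hδ
  have hM : 0 < max ‖a‖ 1 := lt_max_of_lt_right one_pos
  -- Chosen so that the continuity-of-roots bound `((n + 1) * ε) ^ (1 / n) * max ‖a‖ 1` equals `δ`,
  -- with `n` the degree of `f`.
  have hε : 0 < (δ / max ‖a‖ 1) ^ f.natDegree / (f.natDegree + 1) := by positivity
  obtain ⟨g, hg, hdeg, hcoeff⟩ :=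
    exists_monic_and_natDegree_eq_and_norm_map_algebraMap_coeff_sub_lt hd hf hε
  obtain ⟨b, hb, hab⟩ := exists_aroots_norm_sub_lt_of_norm_coeff_sub_lt hε ha hf
    (hg.map (algebraMap A E)) (by rw [natDegree_map, hdeg]) hcoeff (IsAlgClosed.splits _)
  refine ⟨b, ?_, ?_⟩
  · rw [aroots_def, Polynomial.map_map, (IsAlgClosed.splits g).roots_map, Multiset.mem_map] at hb
    obtain ⟨c, _, rfl⟩ := hb
    exact ⟨algebraMap A E c, rfl⟩
  · rw [dist_eq_norm]
    refine hab.trans_eq ?_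
    rw [mul_div_cancel₀ _ (by positivity), Real.pow_rpow_inv_natCast (by positivity) hn,
      div_mul_cancel₀ _ hM.ne']

/-- The completed algebraic closure of `k(S)` is an analytic subextension. -/
theorem exists_coe_eq_taClosure [CompleteSpace K] [IsAlgClosed K] (S : Set K) :
    ∃ L : AnalyticSubextension k K, (L.1 : Set K) = taClosure k S := by
  set A : Subfield K := (algebraicClosure (IntermediateField.adjoin k S) K).toSubfield with hA
  have hAC : closure (A : Set K) = taClosure k S := by
    congr 1
    ext x
    exact mem_algebraicClosure_iff
  have : IsAlgClosed A :=
    (algebraicClosure.isAlgClosure (IntermediateField.adjoin k S) K).isAlgClosed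
  set E : Subfield K := A.topologicalClosure with hE
  let : Algebra A E := (Subfield.inclusion A.le_topologicalClosure).toAlgebra
  have hd : DenseRange (algebraMap A E) := by
    intro x
    rw [closure_subtype]
    refine closure_mono ?_ x.2
    exact fun y hy => ⟨_, ⟨⟨y, hy⟩, rfl⟩, rfl⟩
  let : NormedAlgebra E K :=
    { (inferInstance : Algebra E K) with norm_smul_le := fun c x => norm_mul_le (c : K) x }
  have hcl : IsClosed (Set.range (algebraMap E K)) := by
    have : Set.range (algebraMap E K) = E := Subtype.range_coe
    rw [this]
    exact A.isClosed_topologicalClosure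
  have : IsAlgClosed E := isAlgClosed_of_denseRange_of_isClosed hd hcl
  exact ⟨⟨{ E with
      algebraMap_mem' := fun c => A.le_topologicalClosure <| mem_algebraicClosure_iff.2 <|
        isAlgebraic_algebraMap (algebraMap k (IntermediateField.adjoin k S) c) },
    IsClosed.isComplete A.isClosed_topologicalClosure, this⟩, hAC⟩

/-- If enlarging `F` to `G` does not bring it closer to `x`, then `G` meets the completed algebraic
closure of `F(x)` in `F`. -/
theorem mem_of_mem_taClosure_insert [IsUltrametricDist K] [IsAlgClosed K]
    {F G : AnalyticSubextension k K} (hFG : F ≤ G) {x z : K}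
    (hx : Metric.infDist x F.1 ≤ Metric.infDist x G.1) (hzG : z ∈ G.1)
    (hz : z ∈ taClosure k (insert x (F.1 : Set K))) : z ∈ F.1 := by
  have := F.2.2
  have := G.2.2
  have hFne : (F.1 : Set K).Nonempty := ⟨0, zero_mem F.1⟩
  have hFcl : IsClosed (F.1 : Set K) := F.2.1.isClosed
  by_cases hxF : x ∈ F.1
  · exact taClosure_subset F (Set.insert_subset hxF subset_rfl) hz
  have hrange : Set.range (algebraMap F.1 K) = F.1 := Subtype.range_coe
  by_contra hzF
  have hpos := (hFcl.notMem_iff_infDist_pos hFne).1 hzF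
  obtain ⟨w, hw, hzw⟩ := Metric.mem_closure_iff.1 hz _ hpos
  have hw' : IsAlgebraic (IntermediateField.adjoin F.1 {x}) w := by
    have h : IntermediateField.adjoin k (insert x (F.1 : Set K)) =
        (IntermediateField.adjoin F.1 {x}).restrictScalars k := by
      rw [IntermediateField.restrictScalars_adjoin, Set.union_comm]; rfl
    have hw2 : IsAlgebraic ((IntermediateField.adjoin F.1 {x}).restrictScalars k) w := h ▸ hw
    exact hw2
  have h := infDist_le_of_isAlgebraic_adjoin (F := F.1) (K := K) (x := x) (z := z) (w := w)
    (fun y hy => hrange ▸ mem_of_isAlgebraic_of_isAlgClosed hy)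
    (hrange ▸ (hFcl.notMem_iff_infDist_pos hFne).1 hxF) (fun y hy => ?_) hw'
  · rw [hrange, ← dist_eq_norm] at h
    exact absurd hzw h.not_gt
  · have hle : (IntermediateField.adjoin F.1 {z}).restrictScalars k ≤ G.1 := by
      rw [IntermediateField.restrictScalars_adjoin, IntermediateField.adjoin_le_iff]
      exact Set.union_subset hFG (Set.singleton_subset_iff.2 hzG)
    have hy2 : IsAlgebraic ((IntermediateField.adjoin F.1 {z}).restrictScalars k) y := hy
    have hyG : y ∈ G.1 := mem_of_isAlgebraic_of_isAlgClosed (isAlgebraic_of_le hle hy2)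
    rw [hrange, ← dist_eq_norm]
    exact hx.trans (Metric.infDist_le_dist_of_mem hyG)

/-- For a chain of fields along which all antitone real functions stabilize, adjoining finitely
many elements to a large member of the chain adds no elements of the other members. -/
theorem exists_forall_inter_taClosure_subset [IsUltrametricDist K] [CompleteSpace K]
    [IsAlgClosed K] {ι : Type*} [LinearOrder ι]
    (hι : ∀ f : ι → ℝ, (∀ i, 0 ≤ f i) → Antitone f → ∃ i, ∀ j, i ≤ j → f j = f i)
    (T : Finset K) (F : ι → AnalyticSubextension k K) (hF : Monotone F) :
    ∃ i, ∀ j, i ≤ j → ∀ l, ∀ z ∈ (F l).1,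
      z ∈ taClosure k ((F j).1 ∪ T : Set K) → z ∈ (F j).1 := by
  classical
  induction T using Finset.induction_on generalizing F with
  | empty =>
    obtain ⟨i, _⟩ := hι (fun _ => 0) (fun _ => le_rfl) antitone_const
    refine ⟨i, fun j _ l z _ hz => ?_⟩
    exact taClosure_subset (F j) (by simp) hz
  | insert x T _ ih =>
    -- The induction hypothesis is applied to the completed closures of `F_i(x)`. These may coincide
    -- for different `i`, so only monotonicity is assumed of the chain.
    choose L hL using fun i => exists_coe_eq_taClosure (k := k) (insert x ((F i).1 : Set K))
    have hLmono : Monotone L := fun i j hij => by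
      change ((L i).1 : Set K) ⊆ (L j).1
      rw [hL, hL]
      exact taClosure_mono (Set.insert_subset_insert (hF hij))
    have hFL : ∀ i, insert x ((F i).1 : Set K) ⊆ (L i).1 := fun i => by
      rw [hL]
      exact subset_taClosure _
    obtain ⟨i₁, h₁⟩ := ih L hLmono
    obtain ⟨i₂, h₂⟩ := hι (fun i => Metric.infDist x (F i).1) (fun _ => Metric.infDist_nonneg)
      fun i j hij => Metric.infDist_le_infDist_of_subset (hF hij) ⟨0, zero_mem (F i).1⟩
    refine ⟨max i₁ i₂, fun j hj l z hzl hz => ?_⟩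
    rcases le_total l j with hlj | hjl
    · exact hF hlj hzl
    have hzL : z ∈ (L j).1 := by
      refine h₁ j ((le_max_left _ _).trans hj) l z (hFL l (Set.mem_insert_of_mem _ hzl)) ?_
      refine taClosure_mono ?_ hz
      rw [Finset.coe_insert, Set.union_insert, ← Set.insert_union]
      exact Set.union_subset_union_left _ (hFL j)
    have hj₂ := (le_max_right _ _).trans hj
    refine mem_of_mem_taClosure_insert (hF hjl) (le_of_eq ?_) hzl (x := x) ?_
    · exact (h₂ j hj₂).trans (h₂ l (hj₂.trans hjl)).symm
    · rw [← hL]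
      exact hzL

end TAClosure

/-! ### Chains indexed by ordinals and the construction of independent elements. -/

section Chain

/-- A nonincreasing nonnegative real function on `ω₁` is eventually constant. -/
theorem exists_forall_le_eq_of_antitone_omega_one (f : Set.Iio (ω_ 1 : Ordinal.{u}) → ℝ)
    (hf0 : ∀ i, 0 ≤ f i) (hf : Antitone f) : ∃ i, ∀ j, i ≤ j → f j = f i := by
  have : Nonempty (Set.Iio (ω_ 1 : Ordinal.{u})) := ⟨⟨0, Ordinal.omega_pos 1⟩⟩
  have hbdd : BddBelow (Set.range f) := ⟨0, by rintro _ ⟨i, rfl⟩; exact hf0 i⟩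
  have h : ∀ n : ℕ, ∃ i, f i < (⨅ i, f i) + 1 / (n + 1) := fun n =>
    exists_lt_of_ciInf_lt (lt_add_of_pos_right _ (by positivity))
  choose t ht using h
  -- Countably many indices approximating the infimum are bounded below `ω_ 1`; from their supremum
  -- on, `f` equals its infimum.
  have hsup : ⨆ n, (t n : Ordinal.{u}) < ω_ 1 := Ordinal.iSup_lt_omega_one fun n => (t n).2
  refine ⟨⟨_, hsup⟩, fun j hj => ?_⟩
  have key : ∀ l : Set.Iio (ω_ 1 : Ordinal.{u}), ⟨_, hsup⟩ ≤ l → f l = ⨅ i, f i := by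
    intro l hl
    refine le_antisymm (le_of_forall_pos_lt_add fun ε hε => ?_) (ciInf_le hbdd l)
    obtain ⟨n, hn⟩ := exists_nat_one_div_lt hε
    have hnl : t n ≤ l := (show (t n : Ordinal.{u}) ≤ _ from
      (Ordinal.le_iSup (fun n => (t n : Ordinal.{u})) n)).trans hl
    exact (hf hnl).trans_lt ((ht n).trans (by gcongr))
  rw [key j hj, key _ le_rfl]

variable {k K : Type*} [NormedField k] [NormedField K] [NormedAlgebra k K]

/-- Every proper subset of `T` lies in some `T \ {x}`, so removing single points suffices. -/
theorem tAIndependent_of_forall_notMem {T : Set K} (h : ∀ x ∈ T, x ∉ taClosure k (T \ {x})) :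
    TAIndependent k T := by
  intro S hS
  obtain ⟨x, hxT, hxS⟩ := Set.exists_of_ssubset hS
  refine ⟨taClosure_mono hS.subset, fun hle => h x hxT ?_⟩
  exact taClosure_mono (Set.subset_sdiff_singleton hS.subset hxS) (hle (subset_taClosure T hxT))

/-- In a chain of length more than `ω₁ * d`, one finds `n + 1` elements that are independent over
a member of the chain with index at least `ω₁ * (d - n)`. -/
theorem exists_independent_of_chain [IsUltrametricDist K] [CompleteSpace K]
    [IsAlgClosed K] {a : Ordinal.{u}} (F : Set.Iic a → AnalyticSubextension k K)
    (hF : StrictMono F) {d : ℕ} (hd : ω_ 1 * (d : Ordinal.{u}) < a) {n m : ℕ} (hnm : n + m = d) :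
    ∃ i : Set.Iic a, ω_ 1 * (m : Ordinal.{u}) ≤ i ∧ ∃ T : Finset K, T.card = n + 1 ∧
      ∀ x ∈ T, x ∉ taClosure k ((F i).1 ∪ (T \ {x}) : Set K) := by
  classical
  induction n generalizing m with
  | zero =>
    obtain rfl : m = d := by omega
    let i : Set.Iic a := ⟨ω_ 1 * (m : Ordinal.{u}), hd.le⟩
    obtain ⟨x, -, hx⟩ := Set.exists_of_ssubset
      (show ((F i).1 : Set K) ⊂ (F ⟨a, Set.self_mem_Iic⟩).1 from hF (show i < ⟨a, _⟩ from hd))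
    refine ⟨i, le_rfl, {x}, by simp, fun y hy hy' => hx ?_⟩
    obtain rfl := Finset.mem_singleton.1 hy
    exact taClosure_subset (F i) (by simp) hy'
  | succ n ih =>
    obtain ⟨i, hi, T, hT, hTi⟩ := ih (m := m + 1) (by omega)
    have hlt : ∀ t : Ordinal.{u}, t < ω_ 1 →
        ω_ 1 * (m : Ordinal.{u}) + t < ω_ 1 * ((m + 1 : ℕ) : Ordinal.{u}) := by
      intro t ht
      rw [Nat.cast_succ, mul_add_one]
      gcongr
    let c : Set.Iio (ω_ 1 : Ordinal.{u}) → Set.Iic a := fun t =>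
      ⟨ω_ 1 * (m : Ordinal.{u}) + t, ((hlt t t.2).le.trans hi).trans i.2⟩
    have hc : StrictMono c := fun s t hst => by
      change ω_ 1 * (m : Ordinal.{u}) + s < ω_ 1 * (m : Ordinal.{u}) + t
      gcongr
    have hci : ∀ t, c t < i := fun t => (hlt t t.2).trans_le hi
    obtain ⟨t, ht⟩ := exists_forall_inter_taClosure_subset
      exists_forall_le_eq_of_antitone_omega_one T (F ∘ c) (hF.comp hc).monotone
    let t' : Set.Iio (ω_ 1 : Ordinal.{u}) :=
      ⟨Order.succ t, (Cardinal.isSuccLimit_omega 1).succ_lt t.2⟩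
    obtain ⟨x, hxt', hxt⟩ := Set.exists_of_ssubset
      (show ((F (c t)).1 : Set K) ⊂ (F (c t')).1 from hF (hc (Order.lt_succ (t : Ordinal.{u}))))
    have hxi : x ∈ (F i).1 := (hF (hci t')).le hxt'
    have hxT : x ∉ T := fun h =>
      hTi x h (subset_taClosure _ (Set.mem_union_left _ hxi))
    refine ⟨c t, le_self_add, insert x T, by rw [Finset.card_insert_of_notMem hxT, hT], ?_⟩
    intro y hy hy'
    rcases Finset.mem_insert.1 hy with rfl | hyT
    · refine hxt (ht t le_rfl t' y hxt' (taClosure_mono ?_ hy'))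
      simp only [Finset.coe_insert, Function.comp]
      grind
    -- The new element already lies in `F i`, so a dependence of `y` over `F (c t)` would be one
    -- over `F i` on the old set.
    · refine hTi y hyT (taClosure_mono ?_ hy')
      have hle : ((F (c t)).1 : Set K) ⊆ (F i).1 := (hF (hci t)).le
      rintro z (hz | ⟨hz, hzy⟩)
      · exact Or.inl (hle hz)
      · rcases Finset.mem_insert.1 hz with rfl | hz
        · exact Or.inl hxi
        · exact Or.inr ⟨hz, hzy⟩

end Chain

/-- The ordinal `ω_ 1 * d` is the sum of `d` copies of `ω_1`. -/
theorem mainTheorem11 {k : Type*} {K : Type*}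
    [NormedField k] [IsUltrametricDist k] [CompleteSpace k] [IsAlgClosed k]
    [NormedField K] [IsUltrametricDist K] [CompleteSpace K] [IsAlgClosed K]
    [NormedAlgebra k K]
    (hp : 0 < ringChar (AnalyticResidueField k))
    (d : ℕ) (hd : topdeg k K = d) :
    chainCofinality (AnalyticSubextension k K) ≤ ω_ 1 * d := by
  rw [chainCofinality_le_iff]
  intro a F hF
  by_contra! ha
  -- With `n = d` all blocks are used up; independence over `F i` implies independence over `k`.
  obtain ⟨i, -, T, hT, hTi⟩ := exists_independent_of_chain F hF ha (n := d) (m := 0) rfl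
  have hind : TAIndependent k (T : Set K) := tAIndependent_of_forall_notMem fun x hx hx' =>
    hTi x hx (taClosure_mono Set.subset_union_right hx')
  have hle := mk_le_topdeg k K T hind
  simp only [hd, Finset.coe_sort_coe, Cardinal.mk_coe_finset, hT, Nat.cast_le] at hle
  omega
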